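/- Let $1<\alpha\le 2$, $0<\beta\le 1$, $\lambda,\mu\in\mathbb{R}$, and let $g:[0,\infty)\to\mathbb{R}$ be continuous. For $\nu>0$ let $$(I^{\nu}y)(t)=\frac{1}{\Gamma(\nu)}\int_0^t (t-s)^{\nu-1}y(s)\,ds,\qquad I^0y=y,$$ and for $n-1<\nu\le n$, $n\in\mathbb{N}$, let $D^{\nu}y=\frac{d^n}{dt^n}I^{n-\nu}y$ be the Riemann–Liouville derivative (with lower terminal $0$). Let $$E_{a,b,c}(u,v)=\sum_{l=0}^{\infty}\sum_{k=0}^{\infty}\frac{(l+k)!}{\Gamma(la+kb+c)}\,\frac{u^l v^k}{l!\,k!}\qquad(a,b>0)$$ be the bivariate Mittag-Leffler function. Consider the Cauchy problem $$(D^{\alpha}y)(t)-\mu\,(D^{\beta}y)(t)-\lambda y(t)=g(t)\quad(t>0),\qquad \lim_{t\to0+}(I^{2-\alpha}y)(t)=0,\quad \lim_{t\to0+}(D^{\alpha-1}y)(t)=0,$$ where a solution is a continuous function $y:[0,\infty)\to\mathbb{R}$ for which $D^{\alpha}y$ and $D^{\beta}y$ exist at every $t>0$ and which satisfies the equation and both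 initial conditions. Then this problem has exactly one solution, namely $$y(t)=\int_0^t (t-s)^{\alpha-1}E_{\alpha,\alpha-\beta,\alpha}\bigl(\lambda(t-s)^{\alpha},\mu(t-s)^{\alpha-\beta}\bigr)g(s)\,ds,\qquad t\ge0 .$$ (In particular, any solution in $C^2([0,\infty),\mathbb{R})$ is given by this formula.) Moreover $y\in C^2([0,\infty),\mathbb{R})$ if and only if $I^{\alpha-1}g\in C^1([0,\infty),\mathbb{R})$; for $\alpha=2$ this holds for every continuous $g$. -/

import Mathlib

open Set Filter Topology

namespace BagleyTorvik

noncomputable section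

/-- The Riemann–Liouville fractional integral of order `ν ≥ 0` with lower terminal `0`:
`(I^ν y)(t) = (1 / Γ(ν)) ∫₀ᵗ (t - s)^(ν - 1) y(s) ds` for `ν > 0`, and `I^0 y = y`. -/
def rlIntegral (ν : ℝ) (y : ℝ → ℝ) (t : ℝ) : ℝ :=
  open Classical in
  if ν = 0 then y t
  else 1 / Real.Gamma ν * ∫ s in (0 : ℝ)..t, (t - s) ^ (ν - 1) * y s

/-- The Riemann–Liouville fractional derivative of order `α > 0` with lower terminal `0`:
`D^α y = (d/dt)^n I^(n - α) y`, where `n - 1 < α ≤ n`, that is, `n = ⌈α⌉`. -/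
def rlDeriv (α : ℝ) (y : ℝ → ℝ) (t : ℝ) : ℝ :=
  iteratedDeriv ⌈α⌉₊ (rlIntegral ((⌈α⌉₊ : ℝ) - α) y) t

/-- `D^α y` exists on `(0, ∞)`: the function `I^(n - α) y`, `n = ⌈α⌉`, is `n` times differentiable
at every point of `(0, ∞)`. -/
def RLDifferentiable (α : ℝ) (y : ℝ → ℝ) : Prop :=
  ∀ t : ℝ, 0 < t → ∀ k : ℕ, k < ⌈α⌉₊ →
    DifferentiableAt ℝ (iteratedDeriv k (rlIntegral ((⌈α⌉₊ : ℝ) - α) y)) t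

/-- The bivariate Mittag-Leffler function
`E^δ_{α,β,γ}(u, v) = ∑_l ∑_k (δ)_{l+k} / Γ(l α + k β + γ) * u^l v^k / (l! k!)`. -/
def bivariateMLδ (δ α β γ u v : ℝ) : ℝ :=
  ∑' l : ℕ, ∑' k : ℕ,
    (ascPochhammer ℝ (l + k)).eval δ / Real.Gamma (l * α + k * β + γ) *
      (u ^ l * v ^ k / ((l.factorial : ℝ) * (k.factorial : ℝ)))

/-- `E_{α,β,γ} = E^1_{α,β,γ}`. -/
def bivariateML (α β γ u v : ℝ) : ℝ := bivariateMLδ 1 α β γ u v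

/-- `y`, continuous on `[0, ∞)`, solves the Cauchy problem
`D^α y - μ D^β y - lam y = g` on `(0, ∞)`, `I^(2 - α) y (0) = 0`, `I^(1 - α) y (0) = 0`.
As `1 - α` is negative, `I^(1 - α)` stands for the derivative `D^(α - 1)`. The initial values
are limits as `t → 0+`. -/
structure IsSolution (α β μ lam : ℝ) (g y : ℝ → ℝ) : Prop where
  continuousOn : ContinuousOn y (Ici 0)
  differentiable_α : RLDifferentiable α y
  differentiable_β : RLDifferentiable β y
  equation : ∀ t : ℝ, 0 < t → rlDeriv α y t - μ * rlDeriv β y t - lam * y t = g t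
  initial_integral : Tendsto (rlIntegral (2 - α) y) (𝓝[>] 0) (𝓝 0)
  initial_deriv : Tendsto (rlDeriv (α - 1) y) (𝓝[>] 0) (𝓝 0)

/-- `Y(t) = ∫₀ᵗ (t-s)^(α-1) E_{α,α-β,α}(lam (t-s)^α, μ (t-s)^(α-β)) g(s) ds`. -/
def greenIntegral (α β μ lam : ℝ) (g : ℝ → ℝ) (t : ℝ) : ℝ :=
  ∫ s in (0 : ℝ)..t, (t - s) ^ (α - 1) *
    bivariateML α (α - β) α (lam * (t - s) ^ α) (μ * (t - s) ^ (α - β)) * g s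

end

end BagleyTorvik

/-!
The Cauchy problem is turned into a Volterra equation in the space of continuous functions on
`[0, ∞)` with locally uniform convergence, `C(ℝ≥0, ℝ)`. There the fractional integrals `I^ν` are
commuting continuous linear operators (`fracInt`) with the semigroup law `I^ν I^κ = I^(ν + κ)`
(`fracInt_mul`), and `I^1` is injective with the usual derivative.

Put `T = lam I^α + μ I^(α - β)`. The binomial expansion of `T^n` together with the growth of `Γ`
shows that the Neumann series `∑ T^n` converges, as a double series in the powers of `lam` and `μ`,
and inverts `1 - T` on both sides (`resolvent_sub_volterra_resolvent`, `resolvent_sub_volterra`).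
Term-by-term integration of the Mittag-Leffler kernel identifies the Green integral with
`(1 - T)⁻¹ I^α g` (`greenIntegral_eq_resolvent`).

* Existence: with `h = (1 - T)⁻¹ g` the Green integral is `y = I^α h`, hence `D^α y = h` and
  `D^β y = I^(α - β) h`, and the differential equation is `h - T h = g`
  (`isSolution_of_eq_fracInt`).
* Uniqueness: integrating the equation twice from `0` and applying `I^(α - 1)` gives
  `y - T y = I^α g` (`IsSolution.sub_volterra_eq`).
* Regularity: `y = I^1 u` with `u = I^(α - 1) h = (1 - T)⁻¹ I^(α - 1) g`, so `y` is `C^2` exactly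
  when `u` is `C^1`. As `u` and `I^(α - 1) g` vanish at `0`, being `C^1` means for each of them to
  lie in the range of `I^1`, and this range is preserved by `1 - T` and by its inverse
  (`exists_resolvent_eq_fracInt_one_iff`).
-/

namespace BagleyTorvik

open scoped NNReal
open MeasureTheory

/-! ### Fractional integrals as operators on continuous functions -/

lemma intervalIntegrable_one_sub_rpow {ν : ℝ} (hν : 0 < ν) :
    IntervalIntegrable (fun u : ℝ => (1 - u) ^ (ν - 1)) volume 0 1 := by
  simpa using ((intervalIntegral.intervalIntegrable_rpow' (a := 0) (b := 1)
    (by linarith : -1 < ν - 1)).comp_sub_left 1).symm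

lemma integral_one_sub_rpow {ν : ℝ} (hν : 0 < ν) :
    ∫ u in (0 : ℝ)..1, (1 - u) ^ (ν - 1) = 1 / ν := by
  rw [intervalIntegral.integral_comp_sub_left (fun x => x ^ (ν - 1)) 1,
    integral_rpow (Or.inl (by linarith))]
  simp [hν.ne']

lemma intervalIntegrable_one_sub_rpow_mul {ν : ℝ} (hν : 0 < ν) (f : C(ℝ≥0, ℝ)) (t : ℝ≥0) :
    IntervalIntegrable (fun u : ℝ => (1 - u) ^ (ν - 1) * f (t * u.toNNReal)) volume 0 1 :=
  (intervalIntegrable_one_sub_rpow hν).mul_continuousOn (by fun_prop)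

lemma norm_one_sub_rpow_mul_le {ν : ℝ} {f : C(ℝ≥0, ℝ)} {t : ℝ≥0} {M : ℝ}
    (hM : ∀ s ≤ t, |f s| ≤ M) {u : ℝ} (hu : u ∈ Ioc (0 : ℝ) 1) :
    ‖(1 - u) ^ (ν - 1) * f (t * u.toNNReal)‖ ≤ (1 - u) ^ (ν - 1) * M := by
  have h0 : 0 ≤ (1 - u) ^ (ν - 1) := Real.rpow_nonneg (by linarith [hu.2]) _
  rw [norm_mul, Real.norm_of_nonneg h0]
  refine mul_le_mul_of_nonneg_left (hM _ (mul_le_of_le_one_right' ?_)) h0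
  exact Real.toNNReal_le_one.2 hu.2

lemma continuous_integral_one_sub_rpow_mul {ν : ℝ} (hν : 0 < ν) (f : C(ℝ≥0, ℝ)) :
    Continuous fun t : ℝ≥0 => ∫ u in (0 : ℝ)..1, (1 - u) ^ (ν - 1) * f (t * u.toNNReal) := by
  refine continuous_iff_continuousAt.2 fun t₀ => ?_
  obtain ⟨M, hM⟩ := (isCompact_Icc (a := 0) (b := t₀ + 1)).exists_bound_of_continuousOn
    f.continuous.continuousOn
  refine intervalIntegral.continuousAt_of_dominated_interval
    (bound := fun u => (1 - u) ^ (ν - 1) * M) ?_ ?_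
    ((intervalIntegrable_one_sub_rpow hν).mul_const M) ?_
  · refine Eventually.of_forall fun t => ?_
    have := (intervalIntegrable_one_sub_rpow_mul hν f t).aestronglyMeasurable
    rwa [uIoc_of_le zero_le_one]
  · have : ∀ᶠ t in 𝓝 t₀, t < t₀ + 1 := Iio_mem_nhds (lt_add_one t₀)
    filter_upwards [this] with t ht
    refine Eventually.of_forall fun u hu => ?_
    rw [uIoc_of_le zero_le_one] at hu
    exact norm_one_sub_rpow_mul_le (fun s hs => hM s ⟨zero_le, hs.trans ht.le⟩) hu
  · exact Eventually.of_forall fun u _ => by fun_prop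

/-- The Riemann–Liouville integral of order `ν > 0` of a continuous function on `[0, ∞)`, in the
form `(t ^ ν / Γ(ν)) ∫₀¹ (1 - u) ^ (ν - 1) f(t u) du`, whose kernel does not depend on `t`. -/
noncomputable def scaledIntegral {ν : ℝ} (hν : 0 < ν) (f : C(ℝ≥0, ℝ)) : C(ℝ≥0, ℝ) where
  toFun t := (t : ℝ) ^ ν / Real.Gamma ν *
    ∫ u in (0 : ℝ)..1, (1 - u) ^ (ν - 1) * f (t * u.toNNReal)
  continuous_toFun := by
    have h1 : Continuous fun t : ℝ≥0 => (t : ℝ) ^ ν :=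
      NNReal.continuous_coe.rpow_const fun _ => Or.inr hν.le
    exact (h1.div_const _).mul (continuous_integral_one_sub_rpow_mul hν f)

lemma abs_scaledIntegral_le {ν : ℝ} (hν : 0 < ν) {f : C(ℝ≥0, ℝ)} {t : ℝ≥0} {M : ℝ}
    (hM : ∀ s ≤ t, |f s| ≤ M) :
    |scaledIntegral hν f t| ≤ (t : ℝ) ^ ν / Real.Gamma (ν + 1) * M := by
  have hint : ‖∫ u in (0 : ℝ)..1, (1 - u) ^ (ν - 1) * f (t * u.toNNReal)‖ ≤
      ∫ u in (0 : ℝ)..1, (1 - u) ^ (ν - 1) * M :=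
    intervalIntegral.norm_integral_le_of_norm_le zero_le_one
      (Eventually.of_forall fun u hu => norm_one_sub_rpow_mul_le hM hu)
      ((intervalIntegrable_one_sub_rpow hν).mul_const M)
  rw [intervalIntegral.integral_mul_const, integral_one_sub_rpow hν, Real.norm_eq_abs] at hint
  have hΓ := Real.Gamma_pos_of_pos hν
  have h0 : 0 ≤ (t : ℝ) ^ ν / Real.Gamma ν := by positivity
  change |(t : ℝ) ^ ν / Real.Gamma ν * _| ≤ _
  rw [abs_mul, abs_of_nonneg h0, Real.Gamma_add_one hν.ne']
  refine (mul_le_mul_of_nonneg_left hint h0).trans_eq ?_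
  field_simp

/-- `scaledIntegral` as a linear map. -/
noncomputable def scaledIntegralₗ {ν : ℝ} (hν : 0 < ν) : C(ℝ≥0, ℝ) →ₗ[ℝ] C(ℝ≥0, ℝ) where
  toFun := scaledIntegral hν
  map_add' f g := by
    ext t
    simp only [scaledIntegral, ContinuousMap.coe_mk, ContinuousMap.add_apply, mul_add]
    rw [intervalIntegral.integral_add (intervalIntegrable_one_sub_rpow_mul hν f t)
      (intervalIntegrable_one_sub_rpow_mul hν g t), mul_add]
  map_smul' c f := by
    ext t
    simp only [scaledIntegral, ContinuousMap.coe_mk, ContinuousMap.smul_apply, smul_eq_mul,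
      RingHom.id_apply, mul_left_comm _ c, intervalIntegral.integral_const_mul]

lemma continuous_scaledIntegralₗ {ν : ℝ} (hν : 0 < ν) : Continuous (scaledIntegralₗ hν) := by
  refine continuous_iff_continuousAt.2 fun f => ?_
  refine ContinuousMap.tendsto_iff_forall_isCompact_tendstoUniformlyOn.2 fun K hK => ?_
  obtain ⟨b, hb⟩ := hK.bddAbove
  have hu := ContinuousMap.tendsto_iff_forall_isCompact_tendstoUniformlyOn.1
    (tendsto_id (α := C(ℝ≥0, ℝ)) (x := 𝓝 f)) (Icc 0 b) isCompact_Icc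
  rw [Metric.tendstoUniformlyOn_iff] at hu ⊢
  intro ε hε
  have hΓ := Real.Gamma_pos_of_pos (by linarith : 0 < ν + 1)
  set c : ℝ := (b : ℝ) ^ ν / Real.Gamma (ν + 1) with hc
  have hc0 : 0 ≤ c := by positivity
  filter_upwards [hu (ε / (c + 1)) (by positivity)] with g hg t ht
  have htb : t ≤ b := hb ht
  rw [Real.dist_eq, ← ContinuousMap.sub_apply, ← map_sub]
  calc |scaledIntegral hν (f - g) t|
      ≤ (t : ℝ) ^ ν / Real.Gamma (ν + 1) * (ε / (c + 1)) := by
        refine abs_scaledIntegral_le hν fun s hs => ?_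
        have := hg s ⟨zero_le, hs.trans htb⟩
        rw [Real.dist_eq] at this
        exact this.le
    _ ≤ c * (ε / (c + 1)) := by
        rw [hc]
        gcongr
    _ < ε := by
        rw [mul_div_assoc', div_lt_iff₀ (by positivity)]
        nlinarith

open Classical in
/-- The fractional integral of order `ν` as a continuous linear operator on the continuous functions
on `[0, ∞)` with locally uniform convergence. It is the identity for `ν = 0`, and by convention for
`ν < 0`. -/
noncomputable def fracInt (ν : ℝ) : C(ℝ≥0, ℝ) →L[ℝ] C(ℝ≥0, ℝ) :=
  if hν : 0 < ν then ⟨scaledIntegralₗ hν, continuous_scaledIntegralₗ hν⟩ else 1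

@[simp] lemma fracInt_zero : fracInt 0 = 1 := by simp [fracInt]

lemma fracInt_apply {ν : ℝ} (hν : 0 < ν) (f : C(ℝ≥0, ℝ)) (t : ℝ≥0) :
    fracInt ν f t = (t : ℝ) ^ ν / Real.Gamma ν *
      ∫ u in (0 : ℝ)..1, (1 - u) ^ (ν - 1) * f (t * u.toNNReal) := by
  simp only [fracInt, hν, dif_pos]
  rfl

lemma abs_fracInt_le {ν : ℝ} (hν : 0 ≤ ν) {f : C(ℝ≥0, ℝ)} {t : ℝ≥0} {M : ℝ}
    (hM : ∀ s ≤ t, |f s| ≤ M) :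
    |fracInt ν f t| ≤ (t : ℝ) ^ ν / Real.Gamma (ν + 1) * M := by
  rcases hν.eq_or_lt with rfl | hν
  · simpa using hM t le_rfl
  · simp only [fracInt, hν, dif_pos]
    exact abs_scaledIntegral_le hν hM

lemma fracInt_apply_zero {ν : ℝ} (hν : 0 < ν) (f : C(ℝ≥0, ℝ)) : fracInt ν f 0 = 0 := by
  simp [fracInt_apply hν, Real.zero_rpow hν.ne']

/-! ### Comparison with the Riemann–Liouville integral -/

/-- The substitution `s = t u` turns the defining integral into the scaled one. -/
lemma fracInt_eq_integral {ν : ℝ} (hν : 0 < ν) (f : C(ℝ≥0, ℝ)) {y : ℝ → ℝ}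
    (hy : ∀ s : ℝ≥0, y s = f s) (t : ℝ≥0) :
    fracInt ν f t = 1 / Real.Gamma ν * ∫ s in (0 : ℝ)..t, ((t : ℝ) - s) ^ (ν - 1) * y s := by
  rcases eq_or_ne t 0 with rfl | ht
  · simp [fracInt_apply_zero hν]
  have ht0 : (0 : ℝ) < t := by positivity
  have hsub := intervalIntegral.mul_integral_comp_mul_left (a := 0) (b := 1)
    (f := fun s : ℝ => ((t : ℝ) - s) ^ (ν - 1) * y s) (c := (t : ℝ))
  rw [mul_zero, mul_one] at hsub
  rw [fracInt_apply hν, ← hsub]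
  have : ∫ u in (0 : ℝ)..1, ((t : ℝ) - t * u) ^ (ν - 1) * y (t * u) =
      (t : ℝ) ^ (ν - 1) * ∫ u in (0 : ℝ)..1, (1 - u) ^ (ν - 1) * f (t * u.toNNReal) := by
    rw [← intervalIntegral.integral_const_mul]
    refine intervalIntegral.integral_congr fun u hu => ?_
    rw [uIcc_of_le zero_le_one] at hu
    have h1 : y (t * u) = f (t * u.toNNReal) := by
      rw [← hy, NNReal.coe_mul, Real.coe_toNNReal u hu.1]
    rw [h1, ← mul_one_sub, Real.mul_rpow ht0.le (by linarith [hu.2]), mul_assoc]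
  rw [this, Real.rpow_sub_one ht0.ne']
  field_simp

lemma rlIntegral_eq_fracInt {ν : ℝ} (hν : 0 ≤ ν) (f : C(ℝ≥0, ℝ)) {y : ℝ → ℝ}
    (hy : ∀ s : ℝ≥0, y s = f s) (t : ℝ≥0) : rlIntegral ν y t = fracInt ν f t := by
  rcases hν.eq_or_lt with rfl | hν
  · simp [rlIntegral, hy]
  · rw [rlIntegral, if_neg hν.ne', fracInt_eq_integral hν f hy]

/-! ### The semigroup law -/

/-- Values of the Beta function give `I^ν t^p = Γ(p+1)/Γ(p+1+ν) t^(p+ν)`. -/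
lemma fracInt_apply_of_eq_rpow {ν p : ℝ} (hν : 0 ≤ ν) (hp : 0 ≤ p) {f : C(ℝ≥0, ℝ)} {c : ℝ}
    (hf : ∀ s : ℝ≥0, f s = c * (s : ℝ) ^ p) (t : ℝ≥0) :
    fracInt ν f t = c * Real.Gamma (p + 1) / Real.Gamma (p + 1 + ν) * (t : ℝ) ^ (p + ν) := by
  have hΓp : Real.Gamma (p + 1) ≠ 0 := (Real.Gamma_pos_of_pos (by linarith)).ne'
  rcases hν.eq_or_lt with rfl | hν
  · simp [hf, hΓp]
  have hbeta : ∫ u in (0 : ℝ)..1, (1 - u) ^ (ν - 1) * u ^ p =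
      Real.Gamma (p + 1) * Real.Gamma ν / Real.Gamma (p + 1 + ν) := by
    have h := ProbabilityTheory.beta_eq_betaIntegralReal (p + 1) ν (by linarith) hν
    rw [ProbabilityTheory.beta] at h
    rw [h, Complex.betaIntegral, ← Complex.ofReal_re (∫ u in (0 : ℝ)..1, (1 - u) ^ (ν - 1) * u ^ p),
      ← intervalIntegral.integral_ofReal]
    congr 1
    refine intervalIntegral.integral_congr fun u hu => ?_
    rw [uIcc_of_le zero_le_one] at hu
    rw [Complex.ofReal_mul, Complex.ofReal_cpow (by linarith [hu.2]), Complex.ofReal_cpow hu.1,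
      mul_comm]
    push_cast
    simp
  have hΓν : Real.Gamma ν ≠ 0 := (Real.Gamma_pos_of_pos hν).ne'
  have : ∫ u in (0 : ℝ)..1, (1 - u) ^ (ν - 1) * f (t * u.toNNReal) =
      c * (t : ℝ) ^ p * ∫ u in (0 : ℝ)..1, (1 - u) ^ (ν - 1) * u ^ p := by
    rw [← intervalIntegral.integral_const_mul]
    refine intervalIntegral.integral_congr fun u hu => ?_
    rw [uIcc_of_le zero_le_one] at hu
    rw [hf, NNReal.coe_mul, Real.coe_toNNReal u hu.1, Real.mul_rpow t.coe_nonneg hu.1]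
    ring
  rw [fracInt_apply hν, this, hbeta, Real.rpow_add_of_nonneg t.coe_nonneg hp hν.le]
  field_simp

/-- The two sides of the semigroup law agree on powers. -/
lemma fracInt_fracInt_of_eq_rpow {ν κ p : ℝ} (hν : 0 ≤ ν) (hκ : 0 ≤ κ) (hp : 0 ≤ p)
    {f : C(ℝ≥0, ℝ)} {c : ℝ} (hf : ∀ s : ℝ≥0, f s = c * (s : ℝ) ^ p) (t : ℝ≥0) :
    fracInt ν (fracInt κ f) t = fracInt (ν + κ) f t := by
  have hΓ : Real.Gamma (p + κ + 1) ≠ 0 := (Real.Gamma_pos_of_pos (by linarith)).ne'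
  rw [fracInt_apply_of_eq_rpow hν (add_nonneg hp hκ) (fracInt_apply_of_eq_rpow hκ hp hf),
    fracInt_apply_of_eq_rpow (add_nonneg hν hκ) hp hf]
  rw [show p + 1 + κ = p + κ + 1 by ring, show p + 1 + (ν + κ) = p + κ + 1 + ν by ring,
    show p + κ + ν = p + (ν + κ) by ring]
  field_simp

/-- The semigroup law on polynomials, by linearity. -/
lemma fracInt_fracInt_polynomial {ν κ : ℝ} (hν : 0 ≤ ν) (hκ : 0 ≤ κ) (P : Polynomial ℝ)
    {f : C(ℝ≥0, ℝ)} (hf : ∀ s : ℝ≥0, f s = P.eval (s : ℝ)) (t : ℝ≥0) :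
    fracInt ν (fracInt κ f) t = fracInt (ν + κ) f t := by
  induction P using Polynomial.induction_on' generalizing f with
  | add P Q hP hQ =>
    let p : C(ℝ≥0, ℝ) := ⟨fun s => P.eval (s : ℝ), by fun_prop⟩
    let q : C(ℝ≥0, ℝ) := ⟨fun s => Q.eval (s : ℝ), by fun_prop⟩
    have : f = p + q := by ext s; simp [hf, p, q]
    rw [this]
    simp only [map_add, ContinuousMap.add_apply]
    rw [hP (f := p) fun _ => rfl, hQ (f := q) fun _ => rfl]
  | monomial n c =>
    refine fracInt_fracInt_of_eq_rpow hν hκ (Nat.cast_nonneg n) (c := c) (fun s => ?_) t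
    rw [hf, Polynomial.eval_monomial, Real.rpow_natCast]

/-- The semigroup law `I^ν I^κ = I^(ν + κ)`: both sides agree on polynomials, which approximate `f`
uniformly on `[0, t]`. -/
lemma fracInt_mul {ν κ : ℝ} (hν : 0 ≤ ν) (hκ : 0 ≤ κ) :
    fracInt ν * fracInt κ = fracInt (ν + κ) := by
  ext f t
  change fracInt ν (fracInt κ f) t = fracInt (ν + κ) f t
  set A := (t : ℝ) ^ κ / Real.Gamma (κ + 1) with hA
  set B := (t : ℝ) ^ ν / Real.Gamma (ν + 1) with hB
  set C := (t : ℝ) ^ (ν + κ) / Real.Gamma (ν + κ + 1) with hC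
  have hΓκ := Real.Gamma_pos_of_pos (by linarith : 0 < κ + 1)
  have hΓν := Real.Gamma_pos_of_pos (by linarith : 0 < ν + 1)
  have hΓs := Real.Gamma_pos_of_pos (by linarith : 0 < ν + κ + 1)
  have hA0 : 0 ≤ A := by positivity
  have hB0 : 0 ≤ B := by positivity
  have hC0 : 0 ≤ C := by positivity
  refine eq_of_abs_sub_le_all fun ε hε => ?_
  set δ := ε / (B * A + C + 1) with hδ
  have hδ0 : 0 < δ := by positivity
  obtain ⟨P, hP⟩ := exists_polynomial_near_of_continuousOn 0 (t : ℝ) (fun s => f s.toNNReal)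
    (by fun_prop) δ hδ0
  let p : C(ℝ≥0, ℝ) := ⟨fun s => P.eval (s : ℝ), by fun_prop⟩
  have hp := fracInt_fracInt_polynomial hν hκ P (f := p) (fun _ => rfl) t
  have hfp : ∀ s ≤ t, |(f - p) s| ≤ δ := fun s hs => by
    have := hP s ⟨s.2, by exact_mod_cast hs⟩
    rw [abs_sub_comm, Real.toNNReal_coe] at this
    exact this.le
  have h1 : ∀ s ≤ t, |fracInt κ (f - p) s| ≤ A * δ := fun s hs => by
    refine (abs_fracInt_le hκ fun r hr => hfp r (hr.trans hs)).trans ?_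
    rw [hA]
    gcongr
  have h2 : |fracInt ν (fracInt κ (f - p)) t| ≤ B * (A * δ) := abs_fracInt_le hν h1
  have h3 : |fracInt (ν + κ) (f - p) t| ≤ C * δ := abs_fracInt_le (add_nonneg hν hκ) hfp
  have h4 : fracInt ν (fracInt κ f) t - fracInt (ν + κ) f t =
      fracInt ν (fracInt κ (f - p)) t - fracInt (ν + κ) (f - p) t := by
    simp only [map_sub, ContinuousMap.sub_apply]
    linarith
  rw [h4]
  calc _ ≤ B * (A * δ) + C * δ := (abs_sub _ _).trans (add_le_add h2 h3)
    _ ≤ (B * A + C + 1) * δ := by nlinarith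
    _ = ε := by rw [hδ]; field_simp

lemma fracInt_fracInt {ν κ : ℝ} (hν : 0 ≤ ν) (hκ : 0 ≤ κ) (f : C(ℝ≥0, ℝ)) :
    fracInt ν (fracInt κ f) = fracInt (ν + κ) f := by
  rw [← fracInt_mul hν hκ]; rfl

lemma commute_fracInt {ν κ : ℝ} (hν : 0 ≤ ν) (hκ : 0 ≤ κ) :
    Commute (fracInt ν) (fracInt κ) := by
  rw [Commute, SemiconjBy, fracInt_mul hν hκ, fracInt_mul hκ hν, add_comm]

lemma fracInt_pow {ν : ℝ} (hν : 0 ≤ ν) (n : ℕ) : fracInt ν ^ n = fracInt (n * ν) := by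
  induction n with
  | zero => simp
  | succ n ih =>
    rw [pow_succ, ih, fracInt_mul (by positivity) hν]
    congr 1
    push_cast
    ring

/-! ### Convergence of the Mittag-Leffler series -/

/-- `Γ` outgrows every exponential: integrate only over `(R, ∞)`, where `s ^ (x - 1)` is at least
`R ^ (x - 1)`. -/
lemma rpow_mul_exp_neg_le_Gamma {x R : ℝ} (hx : 1 ≤ x) (hR : 0 ≤ R) :
    R ^ (x - 1) * Real.exp (-R) ≤ Real.Gamma x := by
  have hint := Real.GammaIntegral_convergent (by linarith : 0 < x)
  rw [Real.Gamma_eq_integral (by linarith), ← integral_exp_neg_Ioi, ← integral_const_mul]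
  calc ∫ s in Ioi R, R ^ (x - 1) * Real.exp (-s)
      ≤ ∫ s in Ioi R, Real.exp (-s) * s ^ (x - 1) := by
        refine setIntegral_mono_on ((integrableOn_exp_neg_Ioi R).const_mul _)
          (hint.mono_set (Ioi_subset_Ioi hR)) measurableSet_Ioi fun s hs => ?_
        rw [mul_comm]
        exact mul_le_mul_of_nonneg_left
          (Real.rpow_le_rpow hR (le_of_lt hs) (by linarith)) (Real.exp_pos _).le
    _ ≤ ∫ s in Ioi (0 : ℝ), Real.exp (-s) * s ^ (x - 1) := by
        refine setIntegral_mono_set hint ?_ (Ioi_subset_Ioi hR).eventuallyLE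
        filter_upwards [self_mem_ae_restrict measurableSet_Ioi] with s hs
        exact mul_nonneg (Real.exp_pos _).le (Real.rpow_nonneg (le_of_lt hs) _)

lemma rpow_add_mul_natCast {r a b c : ℝ} (hr : 0 ≤ r) (ha : 0 ≤ a) (hb : 0 ≤ b) (hc : 0 ≤ c)
    (l k : ℕ) : r ^ (l * a + k * b + c) = (r ^ a) ^ l * (r ^ b) ^ k * r ^ c := by
  rw [Real.rpow_add_of_nonneg hr (by positivity) hc,
    Real.rpow_add_of_nonneg hr (by positivity) (by positivity), mul_comm (l : ℝ), mul_comm (k : ℝ),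
    Real.rpow_mul_natCast hr, Real.rpow_mul_natCast hr]

/-- Absolute convergence of the bivariate Mittag-Leffler series. With `R` so large that
`4 U ≤ R ^ a` and `4 V ≤ R ^ b`, the bound `Γ(x) ≥ R ^ (x - 1) e ^ (-R)` gives a geometric
majorant. -/
lemma summable_choose_mul_pow_div_Gamma {a b c U V : ℝ} (ha : 0 < a) (hb : 0 < b) (hc : 1 ≤ c)
    (hU : 0 ≤ U) (hV : 0 ≤ V) :
    Summable fun p : ℕ × ℕ => ((p.1 + p.2).choose p.1 : ℝ) * U ^ p.1 * V ^ p.2 /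
      Real.Gamma (p.1 * a + p.2 * b + c) := by
  obtain ⟨R, hR1, hRU, hRV⟩ : ∃ R : ℝ, 1 ≤ R ∧ 4 * U ≤ R ^ a ∧ 4 * V ≤ R ^ b :=
    ((eventually_ge_atTop 1).and (((tendsto_rpow_atTop ha).eventually_ge_atTop _).and
      ((tendsto_rpow_atTop hb).eventually_ge_atTop _))).exists
  have hR0 : 0 < R := by linarith
  have hgeo : Summable fun n : ℕ => (1 / 2 : ℝ) ^ n :=
    summable_geometric_of_lt_one (by norm_num) (by norm_num)
  have hgeo2 := (hgeo.mul_of_nonneg hgeo (fun _ => by positivity)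
    (fun _ => by positivity)).mul_left (Real.exp R)
  refine hgeo2.of_nonneg_of_le (fun p => ?_) fun p => ?_
  · have : 0 < Real.Gamma (p.1 * a + p.2 * b + c) := Real.Gamma_pos_of_pos (by positivity)
    positivity
  obtain ⟨l, k⟩ := p
  simp only
  have hx : 0 ≤ l * a + k * b := by positivity
  have hΓ : ((R ^ a) ^ l * (R ^ b) ^ k) * Real.exp (-R) ≤ Real.Gamma (l * a + k * b + c) := by
    refine le_trans ?_ (rpow_mul_exp_neg_le_Gamma (R := R) (by linarith) hR0.le)
    gcongr
    rw [show (l * a + k * b + c - 1 : ℝ) = l * a + k * b + (c - 1) by ring,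
      rpow_add_mul_natCast hR0.le ha.le hb.le (by linarith)]
    exact le_mul_of_one_le_right (by positivity) (Real.one_le_rpow hR1 (by linarith))
  have hchoose : ((l + k).choose l : ℝ) ≤ 2 ^ l * 2 ^ k := by
    rw [← pow_add]
    exact_mod_cast Nat.choose_le_two_pow (l + k) l
  rw [div_le_iff₀ (lt_of_lt_of_le (by positivity) hΓ)]
  calc ((l + k).choose l : ℝ) * U ^ l * V ^ k
      ≤ (2 ^ l * 2 ^ k) * U ^ l * V ^ k := by gcongr
    _ = Real.exp R * ((1 / 2) ^ l * (1 / 2) ^ k) *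
        (((4 * U) ^ l * (4 * V) ^ k) * Real.exp (-R)) := by
      have h4 : ∀ n : ℕ, (4 : ℝ) ^ n = 2 ^ n * 2 ^ n := fun n => by rw [← mul_pow]; norm_num
      rw [Real.exp_neg, mul_pow, mul_pow, h4, h4, one_div, inv_pow, inv_pow]
      field_simp
    _ ≤ Real.exp R * ((1 / 2) ^ l * (1 / 2) ^ k) *
        (((R ^ a) ^ l * (R ^ b) ^ k) * Real.exp (-R)) := by gcongr
    _ ≤ _ := by gcongr

/-! ### The resolvent of a Volterra operator -/

/-- The Volterra operator `lam I^a + μ I^b`. -/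
noncomputable def volterra (a b lam μ : ℝ) : C(ℝ≥0, ℝ) →L[ℝ] C(ℝ≥0, ℝ) :=
  lam • fracInt a + μ • fracInt b

/-- The term of bidegree `(l, k)` in the expansion of `(lam I^a + μ I^b) ^ (l + k)`. -/
noncomputable def resolventTerm (a b lam μ : ℝ) (p : ℕ × ℕ) : C(ℝ≥0, ℝ) →L[ℝ] C(ℝ≥0, ℝ) :=
  (((p.1 + p.2).choose p.1 : ℝ) * lam ^ p.1 * μ ^ p.2) • fracInt (p.1 * a + p.2 * b)

/-- The Neumann series `∑ (lam I^a + μ I^b)^n f`, arranged as a double series. It converges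
locally uniformly for `a, b > 0` (`summable_resolventTerm`). -/
noncomputable def resolvent (a b lam μ : ℝ) (f : C(ℝ≥0, ℝ)) : C(ℝ≥0, ℝ) :=
  ∑' p, resolventTerm a b lam μ p f

/-- The binomial theorem and the semigroup law. -/
lemma volterra_pow {a b : ℝ} (ha : 0 < a) (hb : 0 < b) (lam μ : ℝ)
    (n : ℕ) :
    volterra a b lam μ ^ n =
      ∑ p ∈ Finset.HasAntidiagonal.antidiagonal n, resolventTerm a b lam μ p := by
  have hcomm : Commute (lam • fracInt a) (μ • fracInt b) :=
    ((commute_fracInt ha.le hb.le).smul_left lam).smul_right μ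
  rw [volterra, hcomm.add_pow']
  refine Finset.sum_congr rfl fun p hp => ?_
  rw [resolventTerm, Finset.HasAntidiagonal.mem_antidiagonal.1 hp, smul_pow, smul_pow,
    fracInt_pow ha.le, fracInt_pow hb.le, smul_mul_smul_comm,
    fracInt_mul (by positivity) (by positivity),
    ← Nat.cast_smul_eq_nsmul ℝ, smul_smul, mul_assoc]

/-- On `[0, B]` the bound `|I^ν f| ≤ B ^ ν / Γ(ν + 1) sup |f|` gives a Mittag-Leffler series as
majorant. -/
lemma summable_resolventTerm {a b : ℝ} (ha : 0 < a) (hb : 0 < b) (lam μ : ℝ)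
    (f : C(ℝ≥0, ℝ)) :
    Summable fun p => resolventTerm a b lam μ p f := by
  refine ContinuousMap.summable_of_locally_summable_norm fun K => ?_
  obtain ⟨B, hB⟩ := K.isCompact.bddAbove
  obtain ⟨M, hM⟩ := (isCompact_Icc (a := 0) (b := B)).exists_bound_of_continuousOn
    f.continuous.continuousOn
  have hM0 : 0 ≤ M := (norm_nonneg _).trans (hM 0 ⟨le_rfl, zero_le⟩)
  have hsum := (summable_choose_mul_pow_div_Gamma ha hb le_rfl
    (U := |lam| * (B : ℝ) ^ a) (V := |μ| * (B : ℝ) ^ b) (by positivity) (by positivity)).mul_right M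
  refine hsum.of_nonneg_of_le (fun _ => norm_nonneg _) fun p => ?_
  obtain ⟨l, k⟩ := p
  have hΓ : 0 < Real.Gamma (l * a + k * b + 1) := Real.Gamma_pos_of_pos (by positivity)
  refine (ContinuousMap.norm_le _ (by positivity)).2 fun t => ?_
  have ht : (t : ℝ≥0) ≤ B := hB t.2
  have h := abs_fracInt_le (by positivity : 0 ≤ l * a + k * b) (f := f) (t := (t : ℝ≥0)) (M := M)
    fun s hs => hM s ⟨zero_le, hs.trans ht⟩
  have hpow : ((t : ℝ≥0) : ℝ) ^ (l * a + k * b) ≤ ((B : ℝ) ^ a) ^ l * ((B : ℝ) ^ b) ^ k := by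
    have := rpow_add_mul_natCast B.coe_nonneg ha.le hb.le le_rfl l k
    rw [add_zero, Real.rpow_zero, mul_one] at this
    rw [← this]
    gcongr
  simp only [resolventTerm, ContinuousMap.restrict_apply, smul_apply,
    ContinuousMap.smul_apply, smul_eq_mul, Real.norm_eq_abs, abs_mul, abs_pow, Nat.abs_cast]
  calc _ ≤ ((l + k).choose l : ℝ) * |lam| ^ l * |μ| ^ k *
        (((B : ℝ) ^ a) ^ l * ((B : ℝ) ^ b) ^ k / Real.Gamma (l * a + k * b + 1) * M) := by
        gcongr
        exact h.trans (by gcongr)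
    _ = _ := by
        rw [mul_pow, mul_pow]
        ring

lemma hasSum_volterra_pow {a b : ℝ} (ha : 0 < a) (hb : 0 < b) (lam μ : ℝ)
    (f : C(ℝ≥0, ℝ)) :
    HasSum (fun n => (volterra a b lam μ ^ n) f) (resolvent a b lam μ f) := by
  have h := (Finset.HasAntidiagonal.sigmaAntidiagonalEquivProd (A := ℕ)).hasSum_iff.2
    (summable_resolventTerm ha hb lam μ f).hasSum
  refine h.sigma fun n => ?_
  rw [volterra_pow ha hb, sum_apply, ← Finset.sum_coe_sort]
  exact hasSum_fintype _

lemma resolvent_sub_volterra_resolvent {a b : ℝ} (ha : 0 < a) (hb : 0 < b) (lam μ : ℝ)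
    (f : C(ℝ≥0, ℝ)) :
    resolvent a b lam μ f - volterra a b lam μ (resolvent a b lam μ f) = f := by
  have h := hasSum_volterra_pow ha hb lam μ f
  have h1 := (volterra a b lam μ).hasSum h
  have h2 := (hasSum_nat_add_iff' 1).2 h
  simp only [Finset.range_one, Finset.sum_singleton, pow_zero, one_apply_eq_self] at h2
  have h3 : HasSum (fun n => volterra a b lam μ ((volterra a b lam μ ^ n) f))
      (resolvent a b lam μ f - f) := by
    simpa only [pow_succ', mul_apply_eq_comp] using h2
  rw [h1.unique h3, sub_sub_cancel]

lemma resolvent_sub_volterra {a b : ℝ} (ha : 0 < a) (hb : 0 < b) (lam μ : ℝ)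
    (h : C(ℝ≥0, ℝ)) :
    resolvent a b lam μ (h - volterra a b lam μ h) = h := by
  have h0 := hasSum_volterra_pow ha hb lam μ h
  have h1 := hasSum_volterra_pow ha hb lam μ (volterra a b lam μ h)
  have h2 := (hasSum_nat_add_iff' 1).2 h0
  simp only [Finset.range_one, Finset.sum_singleton, pow_zero, one_apply_eq_self] at h2
  have h3 : HasSum (fun n => (volterra a b lam μ ^ n) (volterra a b lam μ h))
      (resolvent a b lam μ h - h) := by
    simpa only [pow_succ, mul_apply_eq_comp] using h2
  have h4 := hasSum_volterra_pow ha hb lam μ (h - volterra a b lam μ h)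
  simp only [map_sub] at h4
  rw [h4.unique (h0.sub h1), h1.unique h3, sub_sub_cancel]

lemma eq_resolvent_iff {a b : ℝ} (ha : 0 < a) (hb : 0 < b) (lam μ : ℝ)
    {f h : C(ℝ≥0, ℝ)} :
    h = resolvent a b lam μ f ↔ h - volterra a b lam μ h = f := by
  constructor
  · rintro rfl
    exact resolvent_sub_volterra_resolvent ha hb lam μ f
  · rintro rfl
    exact (resolvent_sub_volterra ha hb lam μ h).symm

lemma volterra_fracInt {a b : ℝ} (ha : 0 < a) (hb : 0 < b) (lam μ : ℝ)
    {ν : ℝ} (hν : 0 ≤ ν) (f : C(ℝ≥0, ℝ)) :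
    volterra a b lam μ (fracInt ν f) = fracInt ν (volterra a b lam μ f) := by
  simp only [volterra, add_apply, smul_apply, map_add,
    map_smul, fracInt_fracInt ha.le hν, fracInt_fracInt hb.le hν, fracInt_fracInt hν ha.le,
    fracInt_fracInt hν hb.le, add_comm ν]

lemma fracInt_resolvent {a b : ℝ} (ha : 0 < a) (hb : 0 < b) (lam μ : ℝ)
    {ν : ℝ} (hν : 0 ≤ ν) (f : C(ℝ≥0, ℝ)) :
    fracInt ν (resolvent a b lam μ f) = resolvent a b lam μ (fracInt ν f) := by
  rw [eq_resolvent_iff ha hb, volterra_fracInt ha hb lam μ hν, ← map_sub,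
    resolvent_sub_volterra_resolvent ha hb]

/-! ### The Green integral as a Neumann series -/

lemma hasSum_bivariateML {a b c : ℝ} (ha : 0 < a) (hb : 0 < b) (hc : 1 ≤ c) (u v : ℝ) :
    HasSum (fun p : ℕ × ℕ => ((p.1 + p.2).choose p.1 : ℝ) * u ^ p.1 * v ^ p.2 /
      Real.Gamma (p.1 * a + p.2 * b + c)) (bivariateML a b c u v) := by
  have hs : Summable (fun p : ℕ × ℕ => ((p.1 + p.2).choose p.1 : ℝ) * u ^ p.1 * v ^ p.2 /
      Real.Gamma (p.1 * a + p.2 * b + c)) := by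
    refine Summable.of_norm ((summable_choose_mul_pow_div_Gamma ha hb hc (abs_nonneg u)
      (abs_nonneg v)).congr fun p => ?_)
    have : 0 < Real.Gamma (p.1 * a + p.2 * b + c) := Real.Gamma_pos_of_pos (by positivity)
    simp [abs_of_pos this]
  convert hs.hasSum using 1
  rw [hs.tsum_prod, bivariateML, bivariateMLδ]
  refine tsum_congr fun l => tsum_congr fun k => ?_
  rw [ascPochhammer_eval_one, Nat.cast_add_choose]
  have h1 : (l.factorial : ℝ) ≠ 0 := by positivity
  have h2 : (k.factorial : ℝ) ≠ 0 := by positivity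
  field_simp

/-- Integrating the Mittag-Leffler kernel term by term against `g` gives the Neumann series of
`I^α g`. -/
lemma greenIntegral_eq_resolvent {α β μ lam : ℝ} (hα : 1 < α) (hβ : β ≤ 1) {g : ℝ → ℝ}
    {f : C(ℝ≥0, ℝ)} (hg : ∀ s : ℝ≥0, g s = f s) (t : ℝ≥0) :
    greenIntegral α β μ lam g t = resolvent α (α - β) lam μ (fracInt α f) t := by
  have ha : 0 < α := by linarith
  have hb : 0 < α - β := by linarith
  set b := α - β with hb_def
  obtain ⟨M, hM⟩ := (isCompact_Icc (a := 0) (b := t)).exists_bound_of_continuousOn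
    f.continuous.continuousOn
  have hM0 : 0 ≤ M := (norm_nonneg _).trans (hM 0 ⟨le_rfl, zero_le⟩)
  have hterm : ∀ {r : ℝ}, 0 ≤ r → ∀ u v : ℝ, ∀ p : ℕ × ℕ,
      ((p.1 + p.2).choose p.1 : ℝ) * (u * r ^ α) ^ p.1 * (v * r ^ b) ^ p.2 /
        Real.Gamma (p.1 * α + p.2 * b + α) * r ^ (α - 1) =
      ((p.1 + p.2).choose p.1 : ℝ) * u ^ p.1 * v ^ p.2 / Real.Gamma (p.1 * α + p.2 * b + α) *
        r ^ (p.1 * α + p.2 * b + α - 1) := by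
    intro r hr u v p
    rw [add_sub_assoc, rpow_add_mul_natCast hr ha.le hb.le (by linarith : 0 ≤ α - 1), mul_pow,
      mul_pow]
    ring
  have hexp : ∀ p : ℕ × ℕ, 0 ≤ p.1 * α + p.2 * b + α - 1 := fun p => by
    have : 0 ≤ p.1 * α + p.2 * b := by positivity
    linarith
  have key := intervalIntegral.hasSum_integral_of_dominated_convergence (a := 0) (b := (t : ℝ))
    (μ := volume) (E := ℝ)
    (F := fun (p : ℕ × ℕ) s => ((p.1 + p.2).choose p.1 : ℝ) * lam ^ p.1 * μ ^ p.2 /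
      Real.Gamma (p.1 * α + p.2 * b + α) *
        (((t : ℝ) - s) ^ (p.1 * α + p.2 * b + α - 1) * f s.toNNReal))
    (f := fun s => ((t : ℝ) - s) ^ (α - 1) *
      bivariateML α b α (lam * ((t : ℝ) - s) ^ α) (μ * ((t : ℝ) - s) ^ b) * g s)
    (fun p _ => ((p.1 + p.2).choose p.1 : ℝ) * (|lam| * (t : ℝ) ^ α) ^ p.1 *
      (|μ| * (t : ℝ) ^ b) ^ p.2 / Real.Gamma (p.1 * α + p.2 * b + α) *
        ((t : ℝ) ^ (α - 1) * M)) ?_ ?_ ?_ ?_ ?_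
  · have hval : ∀ p : ℕ × ℕ, (∫ s in (0 : ℝ)..t, ((p.1 + p.2).choose p.1 : ℝ) * lam ^ p.1 *
        μ ^ p.2 / Real.Gamma (p.1 * α + p.2 * b + α) *
          (((t : ℝ) - s) ^ (p.1 * α + p.2 * b + α - 1) * f s.toNNReal)) =
        resolventTerm α b lam μ p (fracInt α f) t := by
      intro p
      have hpos : 0 < p.1 * α + p.2 * b + α := by positivity
      rw [intervalIntegral.integral_const_mul, resolventTerm, smul_apply,
        fracInt_fracInt (by positivity) ha.le, ContinuousMap.smul_apply, smul_eq_mul,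
        fracInt_eq_integral hpos f (y := fun s => f s.toNNReal) (fun s => by simp)]
      ring
    simp only [hval] at key
    exact key.unique (ContinuousMap.hasSum_apply (summable_resolventTerm ha hb lam μ _).hasSum t)
  · intro p
    have : Continuous fun s : ℝ => ((t : ℝ) - s) ^ (p.1 * α + p.2 * b + α - 1) :=
      (continuous_const.sub continuous_id).rpow_const fun _ => Or.inr (hexp p)
    exact Continuous.aestronglyMeasurable (by fun_prop)
  · refine fun p => Eventually.of_forall fun s hs => ?_
    rw [uIoc_of_le t.coe_nonneg] at hs
    have hΓ : 0 < Real.Gamma (p.1 * α + p.2 * b + α) := Real.Gamma_pos_of_pos (by positivity)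
    have hf : |f s.toNNReal| ≤ M := hM _ ⟨zero_le, Real.toNNReal_le_iff_le_coe.2 hs.2⟩
    have hts : 0 ≤ (t : ℝ) - s := by linarith [hs.2]
    rw [← mul_assoc _ _ M, hterm t.coe_nonneg, ← mul_assoc, norm_mul, norm_mul, norm_div, norm_mul,
      norm_mul, norm_pow, norm_pow, Real.norm_of_nonneg hΓ.le,
      Real.norm_of_nonneg (Real.rpow_nonneg hts _), Real.norm_natCast]
    simp only [Real.norm_eq_abs]
    gcongr
    · exact hexp p
    · linarith [hs.1]
  · exact Eventually.of_forall fun s _ => (summable_choose_mul_pow_div_Gamma ha hb hα.le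
      (by positivity) (by positivity)).mul_right _
  · exact intervalIntegrable_const
  · refine Eventually.of_forall fun s hs => ?_
    rw [uIoc_of_le t.coe_nonneg] at hs
    have hts : 0 ≤ (t : ℝ) - s := by linarith [hs.2]
    have hgs : g s = f s.toNNReal := by rw [← hg, Real.coe_toNNReal s hs.1.le]
    have h := ((hasSum_bivariateML ha hb hα.le (lam * ((t : ℝ) - s) ^ α)
      (μ * ((t : ℝ) - s) ^ b)).mul_right (((t : ℝ) - s) ^ (α - 1))).mul_right (g s)
    simp only [hterm hts] at h
    rw [mul_comm (((t : ℝ) - s) ^ (α - 1))]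
    simpa only [← hgs, mul_assoc] using h

/-! ### Integration of order one -/

lemma fracInt_one_apply (f : C(ℝ≥0, ℝ)) (t : ℝ≥0) :
    fracInt 1 f t = ∫ s in (0 : ℝ)..t, f s.toNNReal := by
  simp [fracInt_eq_integral one_pos f (y := fun s => f s.toNNReal) (fun s => by simp)]

lemma hasDerivWithinAt_fracInt_one (f : C(ℝ≥0, ℝ)) {t : ℝ} (ht : 0 ≤ t) :
    HasDerivWithinAt (fun s : ℝ => fracInt 1 f s.toNNReal) (f t.toNNReal) (Ici 0) t := by
  have h : HasDerivAt (fun x => ∫ s in (0 : ℝ)..x, f s.toNNReal) (f t.toNNReal) t :=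
    (Continuous.integral_hasStrictDerivAt (by fun_prop) 0 t).hasDerivAt
  refine h.hasDerivWithinAt.congr (fun s hs => ?_) ?_
  · rw [fracInt_one_apply, Real.coe_toNNReal s hs]
  · rw [fracInt_one_apply, Real.coe_toNNReal t ht]

lemma hasDerivAt_fracInt_one (f : C(ℝ≥0, ℝ)) {t : ℝ} (ht : 0 < t) :
    HasDerivAt (fun s : ℝ => fracInt 1 f s.toNNReal) (f t.toNNReal) t :=
  (hasDerivWithinAt_fracInt_one f ht.le).hasDerivAt (Ici_mem_nhds ht)

lemma fracInt_one_injective : Function.Injective (fracInt 1) := by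
  intro f g hfg
  ext t
  have h1 := hasDerivWithinAt_fracInt_one f t.coe_nonneg
  have h2 := hasDerivWithinAt_fracInt_one g t.coe_nonneg
  rw [hfg] at h1
  simpa using (uniqueDiffOn_Ici (0 : ℝ) t t.coe_nonneg).eq_deriv _ h1 h2

lemma tendsto_comp_toNNReal (f : C(ℝ≥0, ℝ)) :
    Tendsto (fun t : ℝ => f t.toNNReal) (𝓝[>] 0) (𝓝 (f 0)) := by
  have h : Continuous fun t : ℝ => f t.toNNReal := by fun_prop
  simpa using (h.tendsto 0).mono_left nhdsWithin_le_nhds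

/-- A function on `(0, ∞)` with a derivative continuous up to `0` is recovered from its limit
at `0`. -/
lemma eq_add_fracInt_one_of_hasDerivAt {F : ℝ → ℝ} {G : C(ℝ≥0, ℝ)} {c : ℝ}
    (hF : ∀ t, 0 < t → HasDerivAt F (G t.toNNReal) t) (hlim : Tendsto F (𝓝[>] 0) (𝓝 c))
    {t : ℝ} (ht : 0 < t) : F t = c + fracInt 1 G t.toNNReal := by
  set H : ℝ → ℝ := fun t => F t - fracInt 1 G t.toNNReal with hH
  have hderiv : ∀ t, 0 < t → HasDerivAt H 0 t := fun t ht => by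
    have h := (hF t ht).sub (hasDerivAt_fracInt_one G ht)
    rw [sub_self] at h
    exact h
  have hconst : ∀ s ∈ Ioi (0 : ℝ), H s = H t := fun s hs =>
    isOpen_Ioi.is_const_of_deriv_eq_zero isPreconnected_Ioi
      (fun x hx => (hderiv x hx).differentiableAt.differentiableWithinAt)
      (fun x hx => (hderiv x hx).deriv) hs ht
  have h1 : Tendsto H (𝓝[>] 0) (𝓝 (H t)) :=
    tendsto_const_nhds.congr' (by
      filter_upwards [self_mem_nhdsWithin] with s hs using (hconst s hs).symm)
  have h2 : Tendsto H (𝓝[>] 0) (𝓝 (c - 0)) := by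
    have := hlim.sub (tendsto_comp_toNNReal (fracInt 1 G))
    rwa [fracInt_apply_zero one_pos] at this
  have := tendsto_nhds_unique h1 h2
  simp only [hH] at this
  linarith

lemma contDiffOn_two_fracInt_one_iff (u : C(ℝ≥0, ℝ)) :
    ContDiffOn ℝ 2 (fun t : ℝ => fracInt 1 u t.toNNReal) (Ici 0) ↔
      ContDiffOn ℝ 1 (fun t : ℝ => u t.toNNReal) (Ici 0) := by
  have hd : ∀ t ∈ Ici (0 : ℝ), derivWithin (fun t : ℝ => fracInt 1 u t.toNNReal) (Ici 0) t =
      u t.toNNReal := fun t ht =>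
    (hasDerivWithinAt_fracInt_one u ht).derivWithin (uniqueDiffOn_Ici 0 t ht)
  rw [show (2 : WithTop ℕ∞) = 1 + 1 by norm_num, contDiffOn_succ_iff_derivWithin
    (uniqueDiffOn_Ici 0), contDiffOn_congr hd]
  constructor
  · exact fun h => h.2.2
  · refine fun h => ⟨fun t ht =>
      (hasDerivWithinAt_fracInt_one u ht).differentiableWithinAt, fun h => ?_, h⟩
    exact absurd h (by decide)

/-- The `C^1` functions on `[0, ∞)` that vanish at `0` form the range of `I^1`. -/
lemma contDiffOn_one_iff_exists_fracInt_one {u : C(ℝ≥0, ℝ)} (hu : u 0 = 0) :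
    ContDiffOn ℝ 1 (fun t : ℝ => u t.toNNReal) (Ici 0) ↔ ∃ v, u = fracInt 1 v := by
  rw [contDiffOn_one_iff_derivWithin (uniqueDiffOn_Ici 0)]
  constructor
  · rintro ⟨hd, hc⟩
    set d := derivWithin (fun t : ℝ => u t.toNNReal) (Ici 0) with hd_def
    let v : C(ℝ≥0, ℝ) := ⟨fun t => d t,
      hc.comp_continuous NNReal.continuous_coe fun t => t.coe_nonneg⟩
    refine ⟨v, ?_⟩
    ext t
    have h0 : ∀ s ∈ Ici (0 : ℝ),
        HasDerivWithinAt (fun s : ℝ => u s.toNNReal - fracInt 1 v s.toNNReal) 0 (Ici 0) s := by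
      intro s hs
      have h1 := (hd s hs).hasDerivWithinAt.sub (hasDerivWithinAt_fracInt_one v hs)
      have h2 : v s.toNNReal = d s := by
        change d (s.toNNReal : ℝ) = d s
        rw [Real.coe_toNNReal s hs]
      rw [h2, ← hd_def, sub_self] at h1
      exact h1
    have h := constant_of_has_deriv_right_zero (a := 0) (b := (t : ℝ))
      (fun s hs => ((h0 s hs.1).continuousWithinAt).mono Icc_subset_Ici_self)
      (fun s hs => (h0 s hs.1).mono (Ici_subset_Ici.2 hs.1)) t ⟨t.coe_nonneg, le_rfl⟩
    simp only [Real.toNNReal_coe, Real.toNNReal_zero, hu, fracInt_apply_zero one_pos] at h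
    linarith
  · rintro ⟨v, rfl⟩
    refine ⟨fun t ht => (hasDerivWithinAt_fracInt_one v ht).differentiableWithinAt, ?_⟩
    have hv : Continuous fun t : ℝ => v t.toNNReal := by fun_prop
    exact hv.continuousOn.congr fun t ht =>
      (hasDerivWithinAt_fracInt_one v ht).derivWithin (uniqueDiffOn_Ici 0 t ht)

/-! ### The Cauchy problem and the Volterra equation -/

lemma rlIntegral_eq_fracInt_toNNReal {ν : ℝ} (hν : 0 ≤ ν) (f : C(ℝ≥0, ℝ)) {y : ℝ → ℝ}
    (hy : ∀ s : ℝ≥0, y s = f s) {t : ℝ} (ht : 0 ≤ t) :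
    rlIntegral ν y t = fracInt ν f t.toNNReal := by
  rw [← rlIntegral_eq_fracInt hν f hy, Real.coe_toNNReal t ht]

lemma hasDerivAt_of_eq_fracInt_one {F : ℝ → ℝ} {G : C(ℝ≥0, ℝ)}
    (hF : ∀ t, 0 < t → F t = fracInt 1 G t.toNNReal) {t : ℝ} (ht : 0 < t) :
    HasDerivAt F (G t.toNNReal) t :=
  (hasDerivAt_fracInt_one G ht).congr_of_eventuallyEq
    (by filter_upwards [Ioi_mem_nhds ht] with s hs using hF s hs)

lemma natCeil_eq_two {α : ℝ} (hα1 : 1 < α) (hα2 : α ≤ 2) : ⌈α⌉₊ = 2 :=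
  (Nat.ceil_eq_iff two_ne_zero).2 ⟨by simpa using hα1, by simpa using hα2⟩

lemma natCeil_eq_one {β : ℝ} (hβ0 : 0 < β) (hβ1 : β ≤ 1) : ⌈β⌉₊ = 1 :=
  (Nat.ceil_eq_iff one_ne_zero).2 ⟨by simpa using hβ0, by simpa using hβ1⟩

lemma rlDeriv_of_le_one {β : ℝ} (hβ0 : 0 < β) (hβ1 : β ≤ 1) (y : ℝ → ℝ) :
    rlDeriv β y = deriv (rlIntegral (1 - β) y) := by
  funext t
  rw [rlDeriv, natCeil_eq_one hβ0 hβ1, Nat.cast_one, iteratedDeriv_one]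

lemma rlDeriv_of_le_two {α : ℝ} (hα1 : 1 < α) (hα2 : α ≤ 2) (y : ℝ → ℝ) :
    rlDeriv α y = deriv (deriv (rlIntegral (2 - α) y)) := by
  funext t
  rw [rlDeriv, natCeil_eq_two hα1 hα2, Nat.cast_ofNat, iteratedDeriv_succ, iteratedDeriv_one]

lemma rLDifferentiable_iff_of_le_one {β : ℝ} (hβ0 : 0 < β) (hβ1 : β ≤ 1) (y : ℝ → ℝ) :
    RLDifferentiable β y ↔ ∀ t, 0 < t → DifferentiableAt ℝ (rlIntegral (1 - β) y) t := by
  simp [RLDifferentiable, natCeil_eq_one hβ0 hβ1]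

lemma rLDifferentiable_iff_of_le_two {α : ℝ} (hα1 : 1 < α) (hα2 : α ≤ 2) (y : ℝ → ℝ) :
    RLDifferentiable α y ↔ ∀ t, 0 < t → DifferentiableAt ℝ (rlIntegral (2 - α) y) t ∧
      DifferentiableAt ℝ (deriv (rlIntegral (2 - α) y)) t := by
  simp only [RLDifferentiable, natCeil_eq_two hα1 hα2, Nat.cast_ofNat]
  refine forall₂_congr fun t _ => ⟨fun h => ⟨?_, ?_⟩, fun h k hk => ?_⟩
  · simpa using h 0 (by norm_num)
  · simpa using h 1 (by norm_num)
  · interval_cases k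
    · simpa using h.1
    · simpa using h.2

/-- If `h` solves the Volterra equation `h = f + lam I^α h + μ I^(α - β) h`, then `y = I^α h` has
`D^α y = h` and `D^β y = I^(α - β) h`, and solves the Cauchy problem. -/
lemma isSolution_of_eq_fracInt {α β μ lam : ℝ} (hα1 : 1 < α) (hα2 : α ≤ 2) (hβ0 : 0 < β)
    (hβ1 : β ≤ 1) {g y : ℝ → ℝ} {f h : C(ℝ≥0, ℝ)} (hg : ∀ s : ℝ≥0, g s = f s)
    (hy : ∀ s : ℝ≥0, y s = fracInt α h s) (hh : h - volterra α (α - β) lam μ h = f) :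
    IsSolution α β μ lam g y := by
  have hα0 : 0 ≤ α := by linarith
  have hW : ∀ t, 0 < t → rlIntegral (2 - α) y t = fracInt 1 (fracInt 1 h) t.toNNReal := by
    intro t ht
    rw [rlIntegral_eq_fracInt_toNNReal (by linarith) _ hy ht.le, fracInt_fracInt (by linarith) hα0,
      fracInt_fracInt zero_le_one zero_le_one]
    norm_num
  have hW' : ∀ t, 0 < t → deriv (rlIntegral (2 - α) y) t = fracInt 1 h t.toNNReal :=
    fun t ht => (hasDerivAt_of_eq_fracInt_one hW ht).deriv
  have hV : ∀ t, 0 < t → rlIntegral (1 - β) y t = fracInt 1 (fracInt (α - β) h) t.toNNReal := by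
    intro t ht
    rw [rlIntegral_eq_fracInt_toNNReal (by linarith) _ hy ht.le, fracInt_fracInt (by linarith) hα0,
      fracInt_fracInt zero_le_one (by linarith), show 1 - β + α = 1 + (α - β) by ring]
  refine ⟨?_, ?_, ?_, fun t ht => ?_, ?_, ?_⟩
  · have hc : Continuous fun t : ℝ => fracInt α h t.toNNReal := by fun_prop
    refine hc.continuousOn.congr fun t ht => ?_
    change y t = fracInt α h t.toNNReal
    rw [← hy, Real.coe_toNNReal t ht]
  · exact (rLDifferentiable_iff_of_le_two hα1 hα2 y).2 fun t ht =>
      ⟨(hasDerivAt_of_eq_fracInt_one hW ht).differentiableAt,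
        (hasDerivAt_of_eq_fracInt_one hW' ht).differentiableAt⟩
  · exact (rLDifferentiable_iff_of_le_one hβ0 hβ1 y).2 fun t ht =>
      (hasDerivAt_of_eq_fracInt_one hV ht).differentiableAt
  · rw [rlDeriv_of_le_two hα1 hα2, rlDeriv_of_le_one hβ0 hβ1,
      (hasDerivAt_of_eq_fracInt_one hW' ht).deriv, (hasDerivAt_of_eq_fracInt_one hV ht).deriv]
    have hyt := hy t.toNNReal
    have hgt := hg t.toNNReal
    rw [Real.coe_toNNReal t ht.le] at hyt hgt
    rw [hyt, hgt, ← hh]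
    simp only [volterra, add_apply, smul_apply, ContinuousMap.sub_apply, ContinuousMap.add_apply,
      ContinuousMap.smul_apply, smul_eq_mul]
    ring
  · have := tendsto_comp_toNNReal (fracInt 1 (fracInt 1 h))
    rw [fracInt_apply_zero one_pos] at this
    refine this.congr' ?_
    filter_upwards [self_mem_nhdsWithin] with t ht using (hW t ht).symm
  · have := tendsto_comp_toNNReal (fracInt 1 h)
    rw [fracInt_apply_zero one_pos] at this
    rw [rlDeriv_of_le_one (by linarith) (by linarith), show 1 - (α - 1) = 2 - α by ring]
    refine this.congr' ?_
    filter_upwards [self_mem_nhdsWithin] with t ht using (hW' t ht).symm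

/-- Integrating the differential equation twice from `0` and applying `I^(α - 1)` shows that every
solution of the Cauchy problem solves `y = I^α g + lam I^α y + μ I^(α - β) y`. -/
lemma IsSolution.sub_volterra_eq {α β μ lam : ℝ} (hα1 : 1 < α) (hα2 : α ≤ 2) (hβ0 : 0 < β)
    (hβ1 : β ≤ 1) {g y : ℝ → ℝ} {f z : C(ℝ≥0, ℝ)} (hg : ∀ s : ℝ≥0, g s = f s)
    (hz : ∀ s : ℝ≥0, y s = z s) (hy : IsSolution α β μ lam g y) :
    z - volterra α (α - β) lam μ z = fracInt α f := by
  set W := rlIntegral (2 - α) y with hW_def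
  set V := rlIntegral (1 - β) y with hV_def
  have hdW := (rLDifferentiable_iff_of_le_two hα1 hα2 y).1 hy.differentiable_α
  have hdV := (rLDifferentiable_iff_of_le_one hβ0 hβ1 y).1 hy.differentiable_β
  have hW : ∀ t, 0 < t → W t = fracInt (2 - α) z t.toNNReal := fun t ht =>
    rlIntegral_eq_fracInt_toNNReal (by linarith) z hz ht.le
  have hV : ∀ t, 0 < t → V t = fracInt (1 - β) z t.toNNReal := fun t ht =>
    rlIntegral_eq_fracInt_toNNReal (by linarith) z hz ht.le
  have hVlim : Tendsto V (𝓝[>] 0) (𝓝 (fracInt (1 - β) z 0)) := by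
    refine (tendsto_comp_toNNReal (fracInt (1 - β) z)).congr' ?_
    filter_upwards [self_mem_nhdsWithin] with t ht using (hV t ht).symm
  have hW'lim : Tendsto (deriv W) (𝓝[>] 0) (𝓝 0) := by
    have := hy.initial_deriv
    rwa [rlDeriv_of_le_one (by linarith) (by linarith), show 1 - (α - 1) = 2 - α by ring] at this
  -- For `β = 1` the vanishing of `c` is not yet known: it amounts to `y 0 = 0`.
  set c := -(μ * fracInt (1 - β) z 0) with hc
  have hfirst : ∀ t, 0 < t →
      deriv W t - μ * V t = c + fracInt 1 (lam • z + f) t.toNNReal := by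
    intro t ht
    refine eq_add_fracInt_one_of_hasDerivAt (F := fun t => deriv W t - μ * V t)
      (fun s hs => ?_) ?_ ht
    · have h1 := (hdW s hs).2.hasDerivAt.sub ((hdV s hs).hasDerivAt.const_mul μ)
      have heq := hy.equation s hs
      rw [rlDeriv_of_le_two hα1 hα2, rlDeriv_of_le_one hβ0 hβ1] at heq
      have hzs := hz s.toNNReal
      have hgs := hg s.toNNReal
      rw [Real.coe_toNNReal s hs.le] at hzs hgs
      rw [ContinuousMap.add_apply, ContinuousMap.smul_apply, smul_eq_mul, ← hzs, ← hgs]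
      exact h1.congr_deriv (by linarith)
    · simpa [hc] using hW'lim.sub (hVlim.const_mul μ)
  set G : C(ℝ≥0, ℝ) :=
    μ • fracInt (1 - β) z + ContinuousMap.const ℝ≥0 c + fracInt 1 (lam • z + f) with hG
  have hsecond : ∀ t, 0 < t → W t = 0 + fracInt 1 G t.toNNReal := by
    intro t ht
    refine eq_add_fracInt_one_of_hasDerivAt (fun s hs => ?_) hy.initial_integral ht
    refine (hdW s hs).1.hasDerivAt.congr_deriv ?_
    have h2 := hfirst s hs
    rw [hV s hs] at h2
    simp only [hG, ContinuousMap.add_apply, ContinuousMap.smul_apply, smul_eq_mul,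
      ContinuousMap.const_apply]
    linarith
  have hint : fracInt (2 - α) z = fracInt 1 G := by
    ext t
    rcases eq_or_ne t 0 with rfl | ht
    · have h1 : Tendsto W (𝓝[>] 0) (𝓝 (fracInt (2 - α) z 0)) := by
        refine (tendsto_comp_toNNReal (fracInt (2 - α) z)).congr' ?_
        filter_upwards [self_mem_nhdsWithin] with t ht using (hW t ht).symm
      rw [tendsto_nhds_unique h1 hy.initial_integral, fracInt_apply_zero one_pos]
    · have ht0 : (0 : ℝ) < t := by positivity
      have h1 := hsecond t ht0
      rwa [hW t ht0, zero_add, Real.toNNReal_coe] at h1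
  have hz1 : z = fracInt (α - 1) G := by
    apply fracInt_one_injective
    have h1 := congrArg (fracInt (α - 1)) hint
    rw [fracInt_fracInt (by linarith) (by linarith), fracInt_fracInt (by linarith) zero_le_one,
      show α - 1 + (2 - α) = 1 by ring] at h1
    rw [h1, fracInt_fracInt zero_le_one (by linarith), add_comm]
  have hz0 : z 0 = 0 := by
    rw [hz1, fracInt_apply_zero (by linarith)]
  have hc0 : c = 0 := by
    rcases hβ1.eq_or_lt with rfl | hβ
    · simp [hc, hz0]
    · simp [hc, fracInt_apply_zero (by linarith : 0 < 1 - β)]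
  have hconst : ContinuousMap.const ℝ≥0 (0 : ℝ) = 0 := rfl
  have hz2 : z = μ • fracInt (α - β) z + (lam • fracInt α z + fracInt α f) := by
    conv_lhs => rw [hz1, hG, hc0, hconst, add_zero]
    simp only [map_add, map_smul]
    rw [fracInt_fracInt (by linarith) (by linarith), fracInt_fracInt (by linarith) zero_le_one,
      fracInt_fracInt (by linarith) zero_le_one, show α - 1 + (1 - β) = α - β by ring,
      sub_add_cancel]
  conv_lhs => enter [1]; rw [hz2]
  simp only [volterra, add_apply, smul_apply]
  abel

/-- The resolvent and its inverse commute with `I^1`, so they preserve its range. -/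
lemma exists_resolvent_eq_fracInt_one_iff {a b : ℝ} (ha : 0 < a) (hb : 0 < b) (lam μ : ℝ)
    (f : C(ℝ≥0, ℝ)) :
    (∃ v, resolvent a b lam μ f = fracInt 1 v) ↔ ∃ v, f = fracInt 1 v := by
  constructor
  · rintro ⟨v, hv⟩
    refine ⟨v - volterra a b lam μ v, ?_⟩
    rw [← resolvent_sub_volterra_resolvent ha hb lam μ f, hv,
      volterra_fracInt ha hb lam μ zero_le_one, map_sub]
  · rintro ⟨v, rfl⟩
    exact ⟨resolvent a b lam μ v, (fracInt_resolvent ha hb lam μ zero_le_one v).symm⟩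

end BagleyTorvik

theorem mainTheorem7 (α β μ lam : ℝ) (hα1 : 1 < α) (hα2 : α ≤ 2) (hβ0 : 0 < β) (hβ1 : β ≤ 1)
    (g : ℝ → ℝ) (hg : ContinuousOn g (Ici 0)) :
    BagleyTorvik.IsSolution α β μ lam g (BagleyTorvik.greenIntegral α β μ lam g) ∧
    (∀ y : ℝ → ℝ, BagleyTorvik.IsSolution α β μ lam g y →
      ∀ t : ℝ, 0 ≤ t → y t = BagleyTorvik.greenIntegral α β μ lam g t) ∧
    (ContDiffOn ℝ 2 (BagleyTorvik.greenIntegral α β μ lam g) (Ici 0) ↔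
      ContDiffOn ℝ 1 (BagleyTorvik.rlIntegral (α - 1) g) (Ici 0)) := by
  open BagleyTorvik NNReal in
  have hα0 : 0 < α := by linarith
  have hb : 0 < α - β := by linarith
  have hα1' : 0 < α - 1 := by linarith
  let f : C(ℝ≥0, ℝ) := ⟨fun t => g t, hg.comp_continuous NNReal.continuous_coe NNReal.coe_nonneg⟩
  have hgf : ∀ s : ℝ≥0, g s = f s := fun _ => rfl
  have hgreen := greenIntegral_eq_resolvent (μ := μ) (lam := lam) hα1 hβ1 hgf
  set h := resolvent α (α - β) lam μ f with hh
  have hgreen' : ∀ t : ℝ≥0, greenIntegral α β μ lam g t = fracInt α h t := fun t => by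
    rw [hgreen, fracInt_resolvent hα0 hb lam μ hα0.le]
  refine ⟨isSolution_of_eq_fracInt hα1 hα2 hβ0 hβ1 hgf hgreen'
    (resolvent_sub_volterra_resolvent hα0 hb lam μ f), fun y hy t ht => ?_, ?_⟩
  · let z : C(ℝ≥0, ℝ) := ⟨fun t => y t,
      hy.continuousOn.comp_continuous NNReal.continuous_coe NNReal.coe_nonneg⟩
    have hz := (eq_resolvent_iff hα0 hb lam μ).2
      (hy.sub_volterra_eq hα1 hα2 hβ0 hβ1 hgf (z := z) fun _ => rfl)
    lift t to ℝ≥0 using ht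
    rw [hgreen, ← hz]
    rfl
  · -- With `u = I^(α - 1) h` one has `y = I^1 u` and `u = resolvent (I^(α - 1) g)`.
    have hu : fracInt (α - 1) h = resolvent α (α - β) lam μ (fracInt (α - 1) f) :=
      fracInt_resolvent hα0 hb lam μ hα1'.le f
    have h1 : ∀ t ∈ Ici (0 : ℝ), greenIntegral α β μ lam g t =
        fracInt 1 (fracInt (α - 1) h) t.toNNReal := fun t ht => by
      rw [fracInt_fracInt zero_le_one hα1'.le, add_sub_cancel, ← hgreen', Real.coe_toNNReal t ht]
    have h2 : ∀ t ∈ Ici (0 : ℝ), rlIntegral (α - 1) g t = fracInt (α - 1) f t.toNNReal :=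
      fun t ht => rlIntegral_eq_fracInt_toNNReal hα1'.le f hgf ht
    rw [contDiffOn_congr h1, contDiffOn_congr h2, contDiffOn_two_fracInt_one_iff,
      contDiffOn_one_iff_exists_fracInt_one (fracInt_apply_zero hα1' h),
      contDiffOn_one_iff_exists_fracInt_one (fracInt_apply_zero hα1' f), hu,
      exists_resolvent_eq_fracInt_one_iff hα0 hb]
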